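/- Let $\mathcal{H}$ be a complex Hilbert space, let $m$ and $N_1,\dots,N_m$ be natural numbers, and for $p=1,\dots,m$ and $i=1,\dots,N_p$ let $\mathcal{K}_{p,i}$ be a complex Hilbert space and $A_{p,i}:\mathcal{K}_{p,i}\to\mathcal{H}$ a bounded linear operator. Suppose that $A_{p,i}^*A_{q,j}:\mathcal{K}_{q,j}\to\mathcal{K}_{p,i}$ is compact for all $p\neq q$, $i=1,\dots,N_p$ and $j=1,\dots,N_q$. If for every $p=1,\dots,m$ the set $$\mathcal{R}_p=\sum_{i=1}^{N_p}\operatorname{Ran}(A_{p,i})=\Big\{\sum_{i=1}^{N_p}A_{p,i}x_i \;\Big|\; x_i\in\mathcal{K}_{p,i}\Big\}$$ is closed in $\mathcal{H}$, then $$\sum_{p=1}^m\mathcal{R}_p=\Big\{\sum_{p=1}^m y_p \;\Big|\; y_p\in\mathcal{R}_p\Big\}$$ is closed in $\mathcal{H}$. -/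

import Mathlib

open scoped Pointwise

open Filter Topology ContinuousLinearMap

/-! The sum of the `R_p` is the range of the addition map `S : ⨁ R_p → H`. Closedness of `R_p`
gives, by open mapping and duality, `‖y‖ ≤ c_p ∑ i, ‖A_{p,i}* y‖` on `R_p`. For `y = x_p`, `A_{p,i}*
x_p` is `A_{p,i}* (S x)` minus the cross terms `A_{p,i}* x_q`, `q ≠ p`, which are compact in `x`.
Hence `S` is bounded below modulo a compact operator, and so has closed range. -/

/-- A bounded operator which is bounded below modulo a compact operator has closed range. -/
theorem ContinuousLinearMap.isClosed_range_of_norm_le_add_compact {𝕜 E F G : Type*} [RCLike 𝕜]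
    [NormedAddCommGroup E] [InnerProductSpace 𝕜 E] [CompleteSpace E]
    [NormedAddCommGroup F] [NormedSpace 𝕜 F] [NormedAddCommGroup G] [NormedSpace 𝕜 G]
    (S : E →L[𝕜] F) (C : E →L[𝕜] G) (hC : IsCompactOperator C) (a b : ℝ)
    (h : ∀ x, ‖x‖ ≤ a * ‖S x‖ + b * ‖C x‖) : IsClosed (Set.range S) := by
  have hker : IsClosed (S.ker : Set E) := S.isClosed_ker
  have : CompleteSpace S.ker := hker.completeSpace_coe
  set V : Submodule 𝕜 E := S.kerᗮ with hV
  have hVc : IsClosed (V : Set E) := Submodule.isClosed_orthogonal _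
  have : CompleteSpace V := hVc.completeSpace_coe
  -- Otherwise there are unit vectors in `V` with `S u_n → 0`. Where `C u_n` converges along a
  -- subsequence, `h` makes `u_n` Cauchy; its limit is a unit vector in `ker S ∩ (ker S)ᗮ`.
  have key : ∃ c, ∀ x ∈ V, ‖x‖ ≤ c * ‖S x‖ := by
    by_contra! hcon
    have hseq : ∀ n : ℕ, ∃ x ∈ V, ‖x‖ = 1 ∧ ‖S x‖ ≤ 1 / ((n : ℝ) + 1) := by
      intro n
      obtain ⟨x, hxV, hx⟩ := hcon (n + 1)
      have hx0 : 0 < ‖x‖ := lt_of_le_of_lt (by positivity) hx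
      refine ⟨((‖x‖⁻¹ : ℝ) : 𝕜) • x, V.smul_mem _ hxV, ?_, ?_⟩
      · rw [norm_smul, RCLike.norm_ofReal, abs_of_pos (inv_pos.2 hx0), inv_mul_cancel₀ hx0.ne']
      · rw [map_smul, norm_smul, RCLike.norm_ofReal, abs_of_pos (inv_pos.2 hx0),
          inv_mul_le_iff₀ hx0, mul_one_div, le_div_iff₀ (by positivity)]
        linarith
    choose u huV hu1 huS using hseq
    have hS0 : Tendsto (fun n => S (u n)) atTop (𝓝 0) :=
      squeeze_zero_norm huS tendsto_one_div_add_atTop_nhds_zero_nat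
    obtain ⟨Q, hQ, hCQ⟩ := IsCompactOperator.image_closedBall_subset_compact
      (f := (C : E →ₗ[𝕜] G)) hC 1
    obtain ⟨z, -, φ, hφ, hz⟩ := hQ.tendsto_subseq (x := fun n => C (u n))
      fun n => hCQ ⟨u n, by simp [hu1], rfl⟩
    have hSc : CauchySeq fun n => S (u (φ n)) := (hS0.comp hφ.tendsto_atTop).cauchySeq
    have hCc : CauchySeq fun n => C (u (φ n)) := hz.cauchySeq
    have hc : CauchySeq fun n => u (φ n) := by
      rw [cauchySeq_iff_tendsto_dist_atTop_0] at hSc hCc ⊢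
      refine squeeze_zero (fun _ => dist_nonneg) (fun n => ?_)
        (by simpa using (hSc.const_mul a).add (hCc.const_mul b))
      simpa only [dist_eq_norm, map_sub] using h (u (φ n.1) - u (φ n.2))
    obtain ⟨x, hx⟩ := cauchySeq_tendsto_of_complete hc
    have hxV : x ∈ V := hVc.mem_of_tendsto hx (Eventually.of_forall fun n => huV _)
    have hx1 : ‖x‖ = 1 := tendsto_nhds_unique hx.norm (by simp [hu1])
    have hxS : S x = 0 := tendsto_nhds_unique ((S.continuous.tendsto x).comp hx)
      (hS0.comp hφ.tendsto_atTop)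
    have : x = 0 := by
      have := (Submodule.mem_orthogonal _ _).1 hxV x hxS
      exact inner_self_eq_zero.1 this
    simp [this] at hx1
  obtain ⟨c, hc⟩ := key
  have hrange : Set.range S = Set.range (S ∘L V.subtypeL) := by
    refine Set.Subset.antisymm ?_ (by rintro _ ⟨x, rfl⟩; exact ⟨x, rfl⟩)
    rintro _ ⟨x, rfl⟩
    refine ⟨⟨x - S.ker.starProjection x, Submodule.sub_starProjection_mem_orthogonal x⟩, ?_⟩
    have h0 : S (S.ker.starProjection x) = 0 := Submodule.starProjection_apply_mem S.ker x
    simp [h0]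
  rw [hrange]
  refine AntilipschitzWith.isClosed_range (K := c.toNNReal)
    (AddMonoidHomClass.antilipschitz_of_bound (S ∘L V.subtypeL) fun x => ?_)
    (S ∘L V.subtypeL).uniformContinuous
  exact (hc x x.2).trans (mul_le_mul_of_nonneg_right (Real.le_coe_toNNReal c) (norm_nonneg _))

theorem IsCompactOperator.of_comp_surjective {𝕜 E F G : Type*} [NontriviallyNormedField 𝕜]
    [NormedAddCommGroup E] [NormedSpace 𝕜 E] [CompleteSpace E]
    [NormedAddCommGroup F] [NormedSpace 𝕜 F] [CompleteSpace F] [TopologicalSpace G] [Zero G]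
    {f : F → G} (g : E →L[𝕜] F) (hg : Function.Surjective g)
    (h : IsCompactOperator (f ∘ g)) : IsCompactOperator f := by
  obtain ⟨Q, hQ, hfQ⟩ := h
  refine ⟨Q, hQ, ?_⟩
  have := (g.isOpenMap hg).image_mem_nhds hfQ
  rw [map_zero] at this
  refine mem_of_superset this ?_
  rintro _ ⟨x, hx, rfl⟩
  exact hx

theorem IsCompactOperator.finset_sum {ι E G : Type*} [TopologicalSpace E] [AddCommMonoid E]
    [TopologicalSpace G] [AddCommMonoid G] [ContinuousAdd G] (s : Finset ι) (f : ι → E → G)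
    (h : ∀ i ∈ s, IsCompactOperator (f i)) : IsCompactOperator (∑ i ∈ s, f i) := by
  classical
  induction s using Finset.induction_on with
  | empty => simpa using isCompactOperator_zero
  | insert i s hi ih =>
    rw [Finset.sum_insert hi]
    exact (h i (Finset.mem_insert_self i s)).add
      (ih fun j hj => h j (Finset.mem_insert_of_mem hj))

theorem IsCompactOperator.pi {ι E : Type*} {G : ι → Type*} [TopologicalSpace E] [Zero E]
    [∀ i, TopologicalSpace (G i)] [∀ i, Zero (G i)] [Finite ι] {f : E → ∀ i, G i}
    (h : ∀ i, IsCompactOperator fun x => f x i) : IsCompactOperator f := by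
  choose Q hQ hfQ using h
  refine ⟨Set.univ.pi Q, isCompact_univ_pi hQ, ?_⟩
  filter_upwards [eventually_all.2 hfQ] with x hx i _
  exact hx i

section SumRange

variable {𝕜 ι H : Type*} [RCLike 𝕜] [Fintype ι] {K : ι → Type*}
  [∀ i, NormedAddCommGroup (K i)] [∀ i, InnerProductSpace 𝕜 (K i)]
  [NormedAddCommGroup H] [InnerProductSpace 𝕜 H]

/-- The operator `(x i)ᵢ ↦ ∑ i, A i (x i)` on the product. -/
noncomputable def rowOperator (A : ∀ i, K i →L[𝕜] H) : (∀ i, K i) →L[𝕜] H :=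
  ∑ i, A i ∘L ContinuousLinearMap.proj i

@[simp]
theorem rowOperator_apply (A : ∀ i, K i →L[𝕜] H) (x : ∀ i, K i) :
    rowOperator A x = ∑ i, A i (x i) := by
  simp [rowOperator]

theorem coe_range_rowOperator (A : ∀ i, K i →L[𝕜] H) :
    ((rowOperator A).range : Set H) = ∑ i, Set.range (A i) := by
  ext y
  rw [Set.mem_fintype_sum]
  constructor
  · rintro ⟨x, rfl⟩
    exact ⟨fun i => A i (x i), fun i => ⟨x i, rfl⟩, by simp⟩
  · rintro ⟨g, hg, rfl⟩
    choose x hx using hg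
    exact ⟨x, by simp [hx]⟩

variable [∀ i, CompleteSpace (K i)] [CompleteSpace H]

/-- Open mapping lifts `y` to `x` with `‖x‖ ≤ c‖y‖`; then `‖y‖² = ‖∑ i, ⟪x_i, A_i* y⟫‖`, and one
factor `‖y‖` cancels. -/
theorem exists_norm_le_sum_norm_adjoint (A : ∀ i, K i →L[𝕜] H)
    (hA : IsClosed ((rowOperator A).range : Set H)) :
    ∃ c, 0 ≤ c ∧ ∀ y ∈ (rowOperator A).range, ‖y‖ ≤ c * ∑ i, ‖adjoint (A i) y‖ := by
  have : CompleteSpace (rowOperator A).range := hA.completeSpace_coe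
  obtain ⟨c, hc0, hc⟩ := (rowOperator A).rangeRestrict.exists_preimage_norm_le
    (rowOperator A).toLinearMap.surjective_rangeRestrict
  refine ⟨c, hc0.le, fun y hy => ?_⟩
  obtain ⟨x, hx, hxc⟩ := hc ⟨y, hy⟩
  have hxy : ∑ i, A i (x i) = y := by
    rw [← rowOperator_apply]
    exact congrArg Subtype.val hx
  have hsq : ‖y‖ * ‖y‖ ≤ (c * ∑ i, ‖adjoint (A i) y‖) * ‖y‖ := by
    calc ‖y‖ * ‖y‖ = ‖inner 𝕜 (∑ i, A i (x i)) y‖ := by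
          rw [hxy, inner_self_eq_norm_sq_to_K, norm_pow, RCLike.norm_ofReal, abs_norm, sq]
      _ = ‖∑ i, inner 𝕜 (x i) (adjoint (A i) y)‖ := by
          simp only [sum_inner, adjoint_inner_right]
      _ ≤ ∑ i, ‖x i‖ * ‖adjoint (A i) y‖ :=
          norm_sum_le_of_le _ fun i _ => norm_inner_le_norm _ _
      _ ≤ ∑ i, (c * ‖y‖) * ‖adjoint (A i) y‖ := by
          gcongr with i
          exact (norm_le_pi_norm x i).trans hxc
      _ = (c * ∑ i, ‖adjoint (A i) y‖) * ‖y‖ := by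
          rw [← Finset.mul_sum]; ring
  rcases (norm_nonneg y).eq_or_lt with h0 | h0
  · rw [← h0]; positivity
  · exact le_of_mul_le_mul_right hsq h0

/-- The row operator is open onto its closed range, so compactness of `B` after it descends to `B`
on the range. -/
theorem isCompactOperator_domRestrict_range_rowOperator {G : Type*} [NormedAddCommGroup G]
    [NormedSpace 𝕜 G] (A : ∀ i, K i →L[𝕜] H)
    (hA : IsClosed ((rowOperator A).range : Set H)) (B : H →L[𝕜] G)
    (h : ∀ i, IsCompactOperator (B ∘L A i)) :
    IsCompactOperator (B ∘L (rowOperator A).range.subtypeL) := by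
  have : CompleteSpace (rowOperator A).range := hA.completeSpace_coe
  refine .of_comp_surjective (rowOperator A).rangeRestrict
    (rowOperator A).toLinearMap.surjective_rangeRestrict ?_
  have hsum := IsCompactOperator.finset_sum Finset.univ
    (fun i => (B ∘L A i) ∘ fun x : ∀ i, K i => x i)
    fun i _ => (h i).comp_clm (ContinuousLinearMap.proj (R := 𝕜) i)
  refine (congrArg IsCompactOperator (funext fun x => ?_)).mpr hsum
  change B (rowOperator A x) = _
  simp

end SumRange

theorem PiLp.norm_le_sum_norm {ι : Type*} [Fintype ι] {E : ι → Type*}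
    [∀ i, NormedAddCommGroup (E i)] (x : PiLp 2 E) : ‖x‖ ≤ ∑ i, ‖x i‖ := by
  rw [PiLp.norm_eq_of_L2]
  exact Real.sqrt_le_left (Finset.sum_nonneg fun i _ => norm_nonneg _) |>.2
    (Finset.sum_sq_le_sq_sum_of_nonneg fun i _ => norm_nonneg _)

theorem theorem1p2 {H : Type*} [NormedAddCommGroup H] [InnerProductSpace ℂ H] [CompleteSpace H]
    (m : ℕ) (N : Fin m → ℕ) (K : (p : Fin m) → Fin (N p) → Type*)
    [∀ p i, NormedAddCommGroup (K p i)] [∀ p i, InnerProductSpace ℂ (K p i)]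
    [∀ p i, CompleteSpace (K p i)]
    (A : (p : Fin m) → (i : Fin (N p)) → K p i →L[ℂ] H)
    (hcompact : ∀ (p q : Fin m), p ≠ q → ∀ (i : Fin (N p)) (j : Fin (N q)),
      IsCompactOperator ((ContinuousLinearMap.adjoint (A p i)) ∘L (A q j)))
    (hclosed : ∀ p : Fin m, IsClosed (∑ i : Fin (N p), Set.range (A p i) : Set H)) :
    IsClosed (∑ p : Fin m, ∑ i : Fin (N p), Set.range (A p i) : Set H) := by
  simp only [← coe_range_rowOperator] at hclosed ⊢
  have : ∀ p, CompleteSpace (rowOperator (A p)).range := fun p => (hclosed p).completeSpace_coe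
  -- The `ℓ²` norm makes the direct sum a Hilbert space, as the orthogonal complement of `ker S`
  -- requires.
  let E := PiLp 2 fun p => (rowOperator (A p)).range
  let π (p : Fin m) : E →L[ℂ] H :=
    (rowOperator (A p)).range.subtypeL ∘L PiLp.proj 2 (fun p => (rowOperator (A p)).range) p
  let S : E →L[ℂ] H := ∑ p, π p
  -- `C` collects the cross terms: its `(p, i)` entry is `A_{p,i}*` applied to `S x - x_p`.
  let C : E →L[ℂ] (∀ p, ∀ i, K p i) := ContinuousLinearMap.pi fun p =>
    ContinuousLinearMap.pi fun i => ∑ q ∈ Finset.univ.erase p, adjoint (A p i) ∘L π q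
  have hrange : (∑ p, ((rowOperator (A p)).range : Set H)) = Set.range S := by
    ext y
    rw [Set.mem_fintype_sum]
    constructor
    · rintro ⟨g, hg, rfl⟩
      exact ⟨WithLp.toLp 2 fun p => ⟨g p, hg p⟩, by simp [S, π]; rfl⟩
    · rintro ⟨x, rfl⟩
      exact ⟨fun p => x p, fun p => (x p).2, by simp [S, π]; rfl⟩
  have hC : IsCompactOperator C := by
    refine .pi fun p => .pi fun i => ?_
    have hsum := IsCompactOperator.finset_sum (Finset.univ.erase p)
      (fun q => (adjoint (A p i) ∘L π q : E → K p i)) fun q hq =>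
        (isCompactOperator_domRestrict_range_rowOperator (A q) (hclosed q) (adjoint (A p i))
          (hcompact p q (Finset.ne_of_mem_erase hq).symm i)).comp_clm
            (PiLp.proj 2 (fun p => (rowOperator (A p)).range) q)
    refine (congrArg IsCompactOperator (funext fun x => ?_)).mpr hsum
    simp [C]
  choose c hc0 hc using fun p => exists_norm_le_sum_norm_adjoint (A p) (hclosed p)
  rw [hrange]
  refine isClosed_range_of_norm_le_add_compact S C hC
    (∑ p, c p * ∑ i, ‖adjoint (A p i)‖) (∑ p, c p * ∑ _i : Fin (N p), 1) fun x => ?_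
  have hcoord (p : Fin m) (i : Fin (N p)) :
      adjoint (A p i) (x p) = adjoint (A p i) (S x) - C x p i := by
    have hS : S x = π p x + ∑ q ∈ Finset.univ.erase p, π q x := by
      rw [Finset.add_sum_erase _ (fun q => π q x) (Finset.mem_univ p)]
      simp [S]
    have hCx : C x p i = adjoint (A p i) (∑ q ∈ Finset.univ.erase p, π q x) := by
      simp [C]
    rw [hS, hCx, map_add, add_sub_cancel_right]
    rfl
  calc ‖x‖ ≤ ∑ p, ‖x p‖ := PiLp.norm_le_sum_norm x
    _ ≤ ∑ p, c p * ∑ i, (‖adjoint (A p i)‖ * ‖S x‖ + 1 * ‖C x‖) := by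
      gcongr with p
      refine (hc p (x p) (x p).2).trans (mul_le_mul_of_nonneg_left ?_ (hc0 p))
      gcongr with i
      rw [hcoord, one_mul]
      refine (norm_sub_le _ _).trans (add_le_add (le_opNorm _ _) ?_)
      exact (norm_le_pi_norm (C x p) i).trans (norm_le_pi_norm (C x) p)
    _ = _ := by
      simp only [Finset.sum_add_distrib, ← Finset.sum_mul, mul_add, ← mul_assoc]
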